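/- Let $(X,d_X)$ be a complete separable metric space, let $\mu_X$ be a Borel probability measure on $X$, and let $\alpha=(\alpha_1,\dots,\alpha_n)\in(0,\infty)^n$ with $n<\infty$. For a complete separable metric space $Y$ with a Borel probability measure $\mu_Y$ and $\beta\in(0,\infty)^n$, let $D_Y(\beta)$ be the set of families $\{A_i\}_{i=1}^n$ of pairwise disjoint Borel subsets of $Y$ with $\mu_Y(A_i)\ge\beta_i$ for all $i$. Put $$\operatorname{diam}'(Y;\beta):=\inf\Bigl\{\sup_{1\le i\le n}\operatorname{diam}A_i \;\Big|\; \{A_i\}_{i=1}^n\in D_Y(\beta)\Bigr\}\in[0,\infty],$$ with $\operatorname{diam}'(Y;\beta):=0$ if $D_Y(\beta)=\emptyset$, and $$\operatorname{diam}''(Y;\alpha):=\sup\bigl\{\operatorname{diam}'(Y;\alpha') \;\big|\; \alpha'\in(0,\infty)^n,\ \alpha'_i\le\alpha_i \text{ for all } i\bigr\}.$$ Finally put $$\operatorname{Obsdiam}''(X;\alpha):=\sup\bigl\{\operatorname{diam}''\bigl((\mathbb R,f_*\mu_X);\alpha\bigr) \;\big|\; f:X\to\mathbb R \text{ is } 1\text{-Lipschitz}\bigr\},$$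 where $f_*\mu_X$ is the push-forward measure and $\mathbb R$ carries its usual metric. If $\operatorname{Obsdiam}''(X;\alpha)=0$, then either $D_X(\alpha)=\emptyset$, or there are distinct points $x_1,\dots,x_n\in X$ such that $\mu_X(\{x_i\})\ge\alpha_i$ for every $i=1,\dots,n$. -/

import Mathlib

open MeasureTheory
open scoped ENNReal

/-- `D_X(α)`: the set of families `(A i)` of pairwise disjoint Borel subsets of `X` with
`μ (A i) ≥ α i` for every `i`. The index type `ι` is `Fin n` for a finite tuple `α`
(and `ℕ` for an infinite one). -/
def admissibleFamilies {X ι : Type*} [MeasurableSpace X] (μ : Measure X) (α : ι → ℝ) :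
    Set (ι → Set X) :=
  {A | (∀ i, MeasurableSet (A i)) ∧ (∀ i j, i ≠ j → Disjoint (A i) (A j)) ∧
    ∀ i, ENNReal.ofReal (α i) ≤ μ (A i)}

open Classical in
/-- `diam'(X; α)`: the infimum of `sup_i diam (A i)` over the admissible families, with the
value `0` if there is no admissible family. -/
noncomputable def partialDiam' {X ι : Type*} [MetricSpace X] [MeasurableSpace X]
    (μ : Measure X) (α : ι → ℝ) : ℝ≥0∞ :=
  if admissibleFamilies μ α = ∅ then 0
  else ⨅ A ∈ admissibleFamilies μ α, ⨆ i, Metric.ediam (A i)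

/-- `diam''(X; α)`: the supremum of `diam'(X; α')` over all tuples `α'` of positive numbers,
indexed as `α`, with `α' ≤ α` entrywise. -/
noncomputable def partialDiam'' {X ι : Type*} [MetricSpace X] [MeasurableSpace X]
    (μ : Measure X) (α : ι → ℝ) : ℝ≥0∞ :=
  ⨆ α' ∈ {α' : ι → ℝ | (∀ i, 0 < α' i) ∧ ∀ i, α' i ≤ α i}, partialDiam' μ α'

/-- `Obsdiam''(X; α)`: the supremum of `diam''((ℝ, f_* μ); α)` over all 1-Lipschitz functions
`f : X → ℝ`. -/
noncomputable def obsDiam'' {X ι : Type*} [MetricSpace X] [MeasurableSpace X]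
    (μ : Measure X) (α : ι → ℝ) : ℝ≥0∞ :=
  ⨆ f ∈ {f : X → ℝ | LipschitzWith 1 f}, partialDiam'' (μ.map f) α

open Filter Topology

/-! One 1-Lipschitz function `g` suffices, provided that it separates the sets `A i` and is
injective up to a `μ`-null set of pairs. The separation makes the push-forward admissible for masses
`β i` slightly below `α i`, so its `diam'`, being zero, comes from sets that really shrink; by
tightness they shrink to distinct atoms of the push-forward
(`exists_injective_atoms_of_partialDiam'_eq_zero`). Almost injectivity puts the mass of each such
fibre at one point of `X` (`exists_measure_singleton_eq_measure_fiber`).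

To get `g`, take a Lipschitz function equal to `i` on a compact part of `A i`, add a power series in
`t` whose coefficients are truncated distances to a dense sequence, and rescale. Two distinct points
collide only for a null set of `t`, so Fubini yields a good `t`. -/

theorem tendsto_measure_closedBall_diff_singleton {X : Type*} [MetricSpace X] [MeasurableSpace X]
    [BorelSpace X] (μ : Measure X) [IsFiniteMeasure μ] (b : X) :
    Tendsto (fun m : ℕ => μ (Metric.closedBall b (1 / ((m : ℝ) + 1)) \ {b})) atTop (𝓝 0) := by
  have h := tendsto_measure_iInter_atTop (μ := μ)
    (s := fun m : ℕ => Metric.closedBall b (1 / ((m : ℝ) + 1)) \ {b})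
    (fun m => (Metric.isClosed_closedBall.measurableSet.diff
      (measurableSet_singleton b)).nullMeasurableSet)
    (fun m k hmk => Set.sdiff_subset_sdiff_left
      (Metric.closedBall_subset_closedBall (Nat.one_div_le_one_div hmk)))
    ⟨0, measure_ne_top _ _⟩
  have he : (⋂ m : ℕ, Metric.closedBall b (1 / ((m : ℝ) + 1)) \ {b}) = ∅ := by
    refine Set.eq_empty_of_forall_notMem fun x hx => ?_
    rw [Set.mem_iInter] at hx
    have h0 : dist x b ≤ 0 := ge_of_tendsto' tendsto_one_div_add_atTop_nhds_zero_nat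
      fun m => Metric.mem_closedBall.1 (hx m).1
    exact (hx 0).2 (dist_le_zero.1 h0)
  rwa [he, measure_empty] at h

/-! ### Shrinking sets and atoms -/

theorem tendsto_measure_diff_singleton {X : Type*} [MetricSpace X] [MeasurableSpace X]
    [BorelSpace X] (μ : Measure X) [IsFiniteMeasure μ] {b : X} {A : ℕ → Set X} {p : ℕ → X}
    (hpA : ∀ m, p m ∈ A m) (hp : Tendsto p atTop (𝓝 b))
    (hd : Tendsto (fun m => Metric.ediam (A m)) atTop (𝓝 0)) :
    Tendsto (fun m => μ (A m \ {b})) atTop (𝓝 0) := by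
  refine ENNReal.tendsto_nhds_zero.2 fun ε hε => ?_
  obtain ⟨k, hk⟩ := ((ENNReal.tendsto_nhds_zero.1
    (tendsto_measure_closedBall_diff_singleton μ b)) ε hε).exists
  have hr : (0 : ℝ) < 1 / ((k : ℝ) + 1) / 2 := by positivity
  filter_upwards [hp.eventually (Metric.ball_mem_nhds b hr),
    (ENNReal.tendsto_nhds_zero.1 hd) (ENNReal.ofReal (1 / ((k : ℝ) + 1) / 2))
      (ENNReal.ofReal_pos.2 hr)] with m hm1 hm2
  refine (measure_mono (Set.sdiff_subset_sdiff_left fun x hx => ?_)).trans hk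
  have h1 : dist x (p m) ≤ 1 / ((k : ℝ) + 1) / 2 := by
    have := (Metric.edist_le_ediam_of_mem hx (hpA m)).trans hm2
    rwa [edist_dist, ENNReal.ofReal_le_ofReal_iff hr.le] at this
  have h2 : dist (p m) b < 1 / ((k : ℝ) + 1) / 2 := hm1
  exact Metric.mem_closedBall.2 (by linarith [dist_triangle x (p m) b])

/-- If `diam'` vanishes and there is an admissible family, then there are distinct atoms of the
prescribed masses. -/
theorem exists_injective_atoms_of_partialDiam'_eq_zero {X ι : Type*} [MetricSpace X]
    [CompleteSpace X] [TopologicalSpace.SeparableSpace X] [MeasurableSpace X] [BorelSpace X]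
    [Finite ι] (μ : Measure X) [IsFiniteMeasure μ] {β : ι → ℝ} (hβ : ∀ i, 0 < β i)
    (hne : (admissibleFamilies μ β).Nonempty) (h : partialDiam' μ β = 0) :
    ∃ b : ι → X, Function.Injective b ∧ ∀ i, ENNReal.ofReal (β i) ≤ μ {b i} := by
  have : Fintype ι := Fintype.ofFinite ι
  have hβ' : ∀ i, 0 < ENNReal.ofReal (β i) := fun i => ENNReal.ofReal_pos.2 (hβ i)
  rw [partialDiam', if_neg hne.ne_empty] at h
  have hfam : ∀ m : ℕ, ∃ A ∈ admissibleFamilies μ β,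
      ∀ i, Metric.ediam (A i) ≤ ((m : ℝ≥0∞) + 1)⁻¹ := by
    intro m
    have hlt : (⨅ A ∈ admissibleFamilies μ β, ⨆ i, Metric.ediam (A i)) < ((m : ℝ≥0∞) + 1)⁻¹ := by
      rw [h]
      simp
    simp only [iInf_lt_iff] at hlt
    obtain ⟨A, hA, hlt⟩ := hlt
    exact ⟨A, hA, fun i => (le_iSup (fun i => Metric.ediam (A i)) i).trans hlt.le⟩
  choose A hA hAd using hfam
  -- Tightness: the complement of `K i` is too light to contain any `A m i`, so each `A m i` meets
  -- this fixed compact set and cannot escape to infinity.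
  have hK : ∀ i, ∃ K : Set X, IsCompact K ∧ μ Kᶜ < ENNReal.ofReal (β i) := by
    intro i
    obtain ⟨K, -, hK, hlt⟩ := MeasurableSet.univ.exists_isCompact_sdiff_lt
      (measure_ne_top μ Set.univ) (hβ' i).ne'
    exact ⟨K, hK, by rwa [Set.compl_eq_univ_sdiff]⟩
  choose K hK hKm using hK
  have hp : ∀ m i, ∃ p, p ∈ A m i ∧ p ∈ K i := by
    intro m i
    by_contra! hc
    exact ((hA m).2.2 i).not_gt ((measure_mono fun x hx => hc x hx).trans_lt (hKm i))
  choose p hpA hpK using hp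
  obtain ⟨b, -, φ, hφ, hb⟩ := (isCompact_univ_pi hK).tendsto_subseq
    (x := p) (fun m i _ => hpK m i)
  have hinv : Tendsto (fun m : ℕ => ((m : ℝ≥0∞) + 1)⁻¹) atTop (𝓝 0) := by
    have := (tendsto_add_atTop_iff_nat 1).2 ENNReal.tendsto_inv_nat_nhds_zero
    simpa using this
  have hlim : ∀ i, Tendsto (fun m => μ (A (φ m) i \ {b i})) atTop (𝓝 0) := fun i =>
    tendsto_measure_diff_singleton μ (fun m => hpA (φ m) i) ((tendsto_pi_nhds.1 hb) i)
      ((tendsto_of_tendsto_of_tendsto_of_le_of_le tendsto_const_nhds hinv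
        (fun _ => zero_le) (fun m => hAd m i)).comp hφ.tendsto_atTop)
  -- If `b i` were missing, removing it would change nothing and the mass would stay at least `β i`.
  have hmem : ∀ i, ∀ᶠ m in atTop, b i ∈ A (φ m) i := by
    intro i
    filter_upwards [(hlim i).eventually (gt_mem_nhds (hβ' i))] with m hm
    by_contra hc
    rw [Set.sdiff_singleton_eq_self hc] at hm
    exact ((hA (φ m)).2.2 i).not_gt hm
  refine ⟨b, fun i j hij => ?_, fun i => ?_⟩
  · by_contra hne
    obtain ⟨m, hi, hj⟩ := ((hmem i).and (hmem j)).exists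
    exact Set.disjoint_left.1 ((hA (φ m)).2.1 i j hne) hi (hij ▸ hj)
  · have hlim' : Tendsto (fun m => μ {b i} + μ (A (φ m) i \ {b i})) atTop (𝓝 (μ {b i})) := by
      simpa using (hlim i).const_add (μ {b i})
    refine ge_of_tendsto' hlim' fun m => ((hA (φ m)).2.2 i).trans ?_
    refine (measure_mono ?_).trans (measure_union_le {b i} (A (φ m) i \ {b i}))
    rw [Set.union_sdiff_self]
    exact Set.subset_union_right

/-- A fibre of positive measure of a map that is injective up to a null set of pairs carries its
mass at one point. -/
theorem exists_measure_singleton_eq_measure_fiber {X Y : Type*} [MeasurableSpace X]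
    [MeasurableSingletonClass X] [MeasurableSpace Y] [MeasurableSingletonClass Y]
    (μ : Measure X) [IsFiniteMeasure μ] {f : X → Y}
    (hf : Measurable f) (hinj : ∀ᵐ x ∂μ, ∀ᵐ y ∂μ, f x = f y → x = y) {b : Y}
    (hb : μ.map f {b} ≠ 0) : ∃ x, f x = b ∧ μ.map f {b} ≤ μ {x} := by
  rw [Measure.map_apply hf (measurableSet_singleton b)] at hb ⊢
  obtain ⟨x, hx, hxi⟩ := (frequently_ae_mem_iff.2 hb).and_eventually hinj |>.exists
  refine ⟨x, hx, measure_mono_ae ?_⟩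
  filter_upwards [hxi] with y hy hyb
  exact (hy (hx.trans (Eq.symm hyb))).symm

/-- Only finitely many points have mass at least `a / 2`, so the masses below `a` stay bounded away
from `a`. -/
theorem exists_lt_forall_measure_singleton {X : Type*} [MeasurableSpace X]
    [MeasurableSingletonClass X] (μ : Measure X) [IsFiniteMeasure μ] {a : ℝ} (ha : 0 < a) :
    ∃ c, 0 < c ∧ c < a ∧ ∀ x, ENNReal.ofReal c ≤ μ {x} → ENNReal.ofReal a ≤ μ {x} := by
  have hfin : {x | ENNReal.ofReal (a / 2) ≤ μ {x}}.Finite :=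
    Measure.finite_const_le_meas_of_disjoint_iUnion μ (ENNReal.ofReal_pos.2 (half_pos ha))
      (fun x => measurableSet_singleton x)
      (fun x y hxy => Set.disjoint_singleton.2 hxy) (measure_ne_top _ _)
  have hev : ∀ᶠ c in 𝓝[<] a, ∀ x ∈ {x | ENNReal.ofReal (a / 2) ≤ μ {x}},
      ENNReal.ofReal c ≤ μ {x} → ENNReal.ofReal a ≤ μ {x} := by
    refine (eventually_all_finite hfin).2 fun x _ => ?_
    by_cases hx : ENNReal.ofReal a ≤ μ {x}
    · exact Eventually.of_forall fun _ _ => hx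
    · have hcont : Tendsto ENNReal.ofReal (𝓝[<] a) (𝓝 (ENNReal.ofReal a)) :=
        (ENNReal.continuous_ofReal.tendsto a).mono_left nhdsWithin_le_nhds
      filter_upwards [hcont.eventually (lt_mem_nhds (not_le.1 hx))] with c hc hc'
      exact absurd hc' hc.not_ge
  obtain ⟨c, hc, hca, hc2⟩ := (hev.and ((eventually_mem_nhdsWithin (a := a) (s := Set.Iio a)).and
    (eventually_nhdsWithin_of_eventually_nhds (lt_mem_nhds (half_lt_self ha))))).exists
  exact ⟨c, (half_pos ha).trans hc2, hca, fun x hx =>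
    hc x ((ENNReal.ofReal_le_ofReal (le_of_lt hc2)).trans hx) hx⟩

/-! ### Almost injective perturbations -/

/-- Bounded coefficients give radius at least 1, and the zeros of a nonzero analytic function on a
connected set are discrete there, hence null. -/
theorem ae_tsum_mul_pow_ne_zero {a : ℕ → ℝ} {C : ℝ} (hC : ∀ k, |a k| ≤ C) (ha : a ≠ 0) :
    ∀ᵐ t ∂(volume.restrict (Metric.ball (0 : ℝ) 1)), ∑' k, a k * t ^ k ≠ 0 := by
  set p := FormalMultilinearSeries.ofScalars ℝ a
  have hr : (1 : ℝ≥0∞) ≤ p.radius := by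
    refine p.le_radius_of_bound (r := 1) C fun k => ?_
    simpa [p, FormalMultilinearSeries.ofScalars_norm] using hC k
  have hp : HasFPowerSeriesOnBall p.sum p 0 p.radius :=
    p.hasFPowerSeriesOnBall (zero_lt_one.trans_le hr)
  have hsum : ∀ t, p.sum t = ∑' k, a k * t ^ k := fun t => by
    refine (FormalMultilinearSeries.ofScalars_sum_eq (E := ℝ) a t).trans ?_
    simp only [smul_eq_mul]
  have han : AnalyticOnNhd ℝ p.sum (Metric.ball 0 1) := by
    refine hp.analyticOnNhd.mono ?_
    rw [← Metric.eball_ofReal, ENNReal.ofReal_one]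
    exact Metric.eball_subset_eball hr
  have hex : ∃ t ∈ Metric.ball (0 : ℝ) 1, p.sum t ≠ 0 := by
    by_contra! hc
    have h0 : HasFPowerSeriesAt (0 : ℝ → ℝ) p 0 :=
      hp.hasFPowerSeriesAt.congr (Filter.eventually_of_mem (Metric.ball_mem_nhds 0 one_pos) hc)
    exact ha ((FormalMultilinearSeries.ofScalars_series_eq_zero ℝ).1 h0.eq_zero)
  obtain ⟨t₀, ht₀, hne⟩ := hex
  have hmem := han.preimage_zero_mem_codiscreteWithin hne ht₀
    (Metric.isConnected_ball one_pos)
  filter_upwards [ae_restrict_le_codiscreteWithin Metric.isOpen_ball.measurableSet hmem] with t ht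
  rw [← hsum]
  exact ht

theorem ae_injective_of_forall_ae_ne {T X Y : Type*} [MeasurableSpace T] [MeasurableSpace X]
    [MeasurableSpace Y] [MeasurableEq X] [MeasurableEq Y] {τ : Measure T} [SFinite τ]
    (μ : Measure X) [SFinite μ] {f : T → X → Y} (hf : Measurable (Function.uncurry f))
    (hne : ∀ x y, x ≠ y → ∀ᵐ t ∂τ, f t x ≠ f t y) :
    ∀ᵐ t ∂τ, ∀ᵐ x ∂μ, ∀ᵐ y ∂μ, f t x = f t y → x = y := by
  have hm : MeasurableSet {q : T × (X × X) | f q.1 q.2.1 = f q.1 q.2.2 → q.2.1 = q.2.2} := by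
    have h1 : MeasurableSet {q : T × (X × X) | f q.1 q.2.1 = f q.1 q.2.2} :=
      measurableSet_eq_fun (hf.comp (measurable_fst.prodMk (measurable_fst.comp measurable_snd)))
        (hf.comp (measurable_fst.prodMk (measurable_snd.comp measurable_snd)))
    have h2 : MeasurableSet {q : T × (X × X) | q.2.1 = q.2.2} :=
      measurableSet_eq_fun (measurable_fst.comp measurable_snd) (measurable_snd.comp measurable_snd)
    exact h1.imp h2
  have h := (Measure.ae_ae_comm (μ := τ) (ν := μ.prod μ)
    (p := fun t q => f t q.1 = f t q.2 → q.1 = q.2) hm).2 (Eventually.of_forall fun q => by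
      by_cases hq : q.1 = q.2
      · exact Eventually.of_forall fun _ _ => hq
      · exact (hne _ _ hq).mono fun t ht he => absurd he ht)
  filter_upwards [h] with t ht
  exact Measure.ae_ae_of_ae_prod ht

/-- A Lipschitz function can be perturbed, by an arbitrary amount in `[0, 1]`, into one that is
injective up to a null set of pairs of points. -/
theorem exists_lipschitz_perturbation_ae_injective {X : Type*} [MetricSpace X]
    [TopologicalSpace.SeparableSpace X] [MeasurableSpace X] [BorelSpace X]
    (μ : Measure X) [SFinite μ] {L : NNReal} {u : X → ℝ} (hu : LipschitzWith L u) :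
    ∃ f : X → ℝ, LipschitzWith (L + 1) f ∧ (∀ x, u x ≤ f x ∧ f x < u x + 1) ∧
      ∀ᵐ x ∂μ, ∀ᵐ y ∂μ, f x = f y → x = y := by
  have : SecondCountableTopology X := UniformSpace.secondCountable_of_separable X
  rcases isEmpty_or_nonempty X with hX | hX
  · exact ⟨u, hu.weaken (by simp), fun x => isEmptyElim x, by simp [μ.eq_zero_of_isEmpty]⟩
  set z := TopologicalSpace.denseSeq X
  set d : ℕ → X → ℝ := fun k x => min (dist x (z k)) 1
  have hd0 : ∀ k x, 0 ≤ d k x := fun k x => le_min dist_nonneg zero_le_one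
  have hd1 : ∀ k x, d k x ≤ 1 := fun k x => min_le_right _ _
  have hdl : ∀ k x y, |d k x - d k y| ≤ dist x y := fun k x y => by
    have h := ((LipschitzWith.dist_left (z k)).min_const 1).dist_le_mul x y
    simpa [Real.dist_eq] using h
  have hsep : ∀ x y, (∀ k, d k x = d k y) → x = y := by
    intro x y hxy
    by_contra hne
    have hpos : 0 < min (dist x y / 2) 1 := lt_min (half_pos (dist_pos.2 hne)) one_pos
    obtain ⟨_, hk, ⟨k, rfl⟩⟩ := Metric.dense_iff.1 (TopologicalSpace.denseRange_denseSeq X) x _ hpos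
    have hk' : dist x (z k) < min (dist x y / 2) 1 := by rw [dist_comm]; exact hk
    have h1 := lt_min_iff.1 hk'
    have h2 : d k x = dist x (z k) := min_eq_left h1.2.le
    have h3 := hxy k
    rw [h2] at h3
    have h4 : d k y = dist y (z k) := by
      rcases min_choice (dist y (z k)) 1 with h | h
      · exact h
      · exact absurd (h3.trans h) h1.2.ne
    linarith [dist_triangle_right x y (z k), h1.1]
  -- Clamping `t` makes every bound hold for all real `t`. As `H` is at most 2 and 2-Lipschitz in
  -- `x`, the factor `q t ≤ 1 / 4` keeps the perturbation below 1 and its Lipschitz constant below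
  -- 1.
  set q : ℝ → ℝ := fun t => max 0 (min t (1 / 4)) with hq
  have hq0 : ∀ t, 0 ≤ q t := fun t => le_max_left _ _
  have hq4 : ∀ t, q t ≤ 1 / 4 := fun t => max_le (by norm_num) (min_le_right _ _)
  have hqc : Continuous q := by fun_prop
  have hgeo : ∀ t, HasSum (fun k => q t ^ k) (1 - q t)⁻¹ := fun t =>
    hasSum_geometric_of_lt_one (hq0 t) ((hq4 t).trans_lt (by norm_num))
  have hgeo2 : ∀ t, (1 - q t)⁻¹ ≤ 2 := fun t =>
    inv_le_of_inv_le₀ (by norm_num) (by linarith [hq4 t])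
  have hs : ∀ t x, Summable fun k => d k x * q t ^ k := fun t x =>
    (hgeo t).summable.of_nonneg_of_le (fun k => mul_nonneg (hd0 k x) (pow_nonneg (hq0 t) k))
      fun k => mul_le_of_le_one_left (pow_nonneg (hq0 t) k) (hd1 k x)
  set H : ℝ → X → ℝ := fun t x => ∑' k, d k x * q t ^ k
  have hH0 : ∀ t x, 0 ≤ H t x := fun t x =>
    tsum_nonneg fun k => mul_nonneg (hd0 k x) (pow_nonneg (hq0 t) k)
  have hH2 : ∀ t x, H t x ≤ 2 := fun t x =>
    ((hs t x).tsum_le_tsum (fun k => mul_le_of_le_one_left (pow_nonneg (hq0 t) k) (hd1 k x))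
      (hgeo t).summable).trans ((hgeo t).tsum_eq.trans_le (hgeo2 t))
  have hHl : ∀ t x y, |H t x - H t y| ≤ 2 * dist x y := by
    intro t x y
    have hle : ∀ k, ‖d k x * q t ^ k - d k y * q t ^ k‖ ≤ q t ^ k * dist x y := fun k => by
      rw [← sub_mul, norm_mul, Real.norm_eq_abs, Real.norm_eq_abs,
        abs_of_nonneg (pow_nonneg (hq0 t) k), mul_comm]
      exact mul_le_mul_of_nonneg_left (hdl k x y) (pow_nonneg (hq0 t) k)
    have h := tsum_of_norm_bounded ((hgeo t).mul_right (dist x y)) hle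
    rw [(hs t x).tsum_sub (hs t y)] at h
    exact h.trans (mul_le_mul_of_nonneg_right (hgeo2 t) dist_nonneg)
  have hHc : Continuous (Function.uncurry H) := by
    refine continuous_tsum (u := fun k => (1 / 4 : ℝ) ^ k) (fun k => ?_)
      (summable_geometric_of_lt_one (by norm_num) (by norm_num)) fun k p => ?_
    · have : Continuous (d k) := by fun_prop
      fun_prop
    · rw [Real.norm_eq_abs, abs_of_nonneg (mul_nonneg (hd0 k p.2) (pow_nonneg (hq0 p.1) k))]
      exact (mul_le_of_le_one_left (pow_nonneg (hq0 _) k) (hd1 k _)).trans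
        (pow_le_pow_left₀ (hq0 _) (hq4 _) k)
  have hne : ∀ x y, x ≠ y → ∀ᵐ t ∂(volume.restrict (Set.Ioo (0 : ℝ) (1 / 4))),
      u x + q t * H t x ≠ u y + q t * H t y := by
    intro x y hxy
    -- The extra factor `q t` shifts the series by one, leaving the constant term to `u x - u y`.
    set a : ℕ → ℝ := fun k => Nat.casesOn k (u x - u y) fun k => d k x - d k y
    have hbd : ∀ k, |a k| ≤ max |u x - u y| (dist x y) := by
      rintro (_ | k)
      · exact le_max_left _ _
      · exact (hdl k x y).trans (le_max_right _ _)
    have ha0 : a ≠ 0 := fun h0 => hxy (hsep x y fun k => sub_eq_zero.1 (congrFun h0 (k + 1)))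
    have hsub : Set.Ioo (0 : ℝ) (1 / 4) ⊆ Metric.ball 0 1 := fun t ht => by
      rw [Metric.mem_ball, Real.dist_eq, sub_zero, abs_of_pos ht.1]
      linarith [ht.2]
    filter_upwards [ae_restrict_of_ae_restrict_of_subset hsub (ae_tsum_mul_pow_ne_zero hbd ha0),
      ae_restrict_mem measurableSet_Ioo] with t ht htm heq
    have hqt : q t = t := by
      simp only [hq, min_eq_left htm.2.le, max_eq_right htm.1.le]
    have hsum : HasSum (fun k => a (k + 1) * q t ^ (k + 1)) (q t * (H t x - H t y)) := by
      have hcoef : (fun k => a (k + 1) * q t ^ (k + 1)) =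
          fun k => q t * (d k x * q t ^ k - d k y * q t ^ k) := by
        funext k
        rw [show a (k + 1) = d k x - d k y from rfl]
        ring
      rw [hcoef]
      exact ((hs t x).hasSum.sub (hs t y).hasSum).mul_left (q t)
    rw [hqt] at hsum heq
    have htot : HasSum (fun k => a k * t ^ k) (t * (H t x - H t y) + a 0) := by
      simpa using (hasSum_nat_add_iff (f := fun k => a k * t ^ k) 1).1 hsum
    refine ht (htot.tsum_eq.trans ?_)
    rw [show a 0 = u x - u y from rfl]
    linarith
  have hmeas : Measurable (Function.uncurry fun t x => u x + q t * H t x) := by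
    refine Continuous.measurable ?_
    have := hu.continuous
    have h2 : Continuous fun p : ℝ × X => H p.1 p.2 := hHc
    exact (this.comp continuous_snd).add ((hqc.comp continuous_fst).mul h2)
  have hae := ae_injective_of_forall_ae_ne μ hmeas hne
  have hNe : (ae (volume.restrict (Set.Ioo (0 : ℝ) (1 / 4)))).NeBot := by
    rw [ae_neBot, Ne, Measure.restrict_eq_zero]
    simp
  obtain ⟨t, ht⟩ := hae.exists
  refine ⟨_, ?_, fun x => ⟨?_, ?_⟩, ht⟩
  · refine LipschitzWith.of_dist_le_mul fun x y => ?_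
    have h1 := hu.dist_le_mul x y
    have h2 := mul_le_mul (hq4 t) (hHl t x y) (abs_nonneg _) (by norm_num)
    rw [Real.dist_eq] at h1 ⊢
    rw [show u x + q t * H t x - (u y + q t * H t y) = (u x - u y) + q t * (H t x - H t y) by ring]
    push_cast
    have h3 : |q t * (H t x - H t y)| = q t * |H t x - H t y| := by
      rw [abs_mul, abs_of_nonneg (hq0 t)]
    linarith [abs_add_le (u x - u y) (q t * (H t x - H t y)), dist_nonneg (x := x) (y := y)]
  · linarith [mul_nonneg (hq0 t) (hH0 t x)]
  · linarith [mul_le_mul (hq4 t) (hH2 t x) (hH0 t x) (by norm_num)]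

/-- Disjoint compact sets lie at positive distance, so the step function is Lipschitz on their union
and extends to `X`. -/
theorem exists_lipschitzWith_eq_on_disjoint_compacts {X : Type*} [MetricSpace X] {n : ℕ}
    {K : Fin n → Set X} (hK : ∀ i, IsCompact (K i)) (hd : ∀ i j, i ≠ j → Disjoint (K i) (K j)) :
    ∃ (L : NNReal) (u : X → ℝ), LipschitzWith L u ∧ ∀ i, ∀ x ∈ K i, u x = (i : ℕ) := by
  classical
  have hC : ∀ i j, ∃ C : NNReal, ∀ x ∈ K i, ∀ y ∈ K j,
      |((i : ℕ) : ℝ) - ((j : ℕ) : ℝ)| ≤ C * dist x y := by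
    intro i j
    by_cases hij : i = j
    · exact ⟨0, by simp [hij]⟩
    obtain ⟨r, hr, h⟩ := Metric.exists_pos_forall_lt_edist (hK i) (hK j).isClosed (hd i j hij)
    refine ⟨Real.nnabs ((i : ℕ) - (j : ℕ)) / r, fun x hx y hy => ?_⟩
    have hr' : (0 : ℝ) < r := hr
    have hlt : (r : ℝ) < dist x y := by
      have := h x hx y hy
      rw [edist_nndist] at this
      exact_mod_cast this
    rw [NNReal.coe_div, Real.coe_nnabs, div_mul_eq_mul_div, le_div_iff₀ hr']
    exact mul_le_mul_of_nonneg_left hlt.le (abs_nonneg _)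
  choose C hC using hC
  let u₀ : X → ℝ := fun x => if h : ∃ i, x ∈ K i then ((h.choose : ℕ) : ℝ) else 0
  have hu₀ : ∀ i, ∀ x ∈ K i, u₀ x = (i : ℕ) := by
    intro i x hx
    have h : ∃ i, x ∈ K i := ⟨i, hx⟩
    have hi : h.choose = i := by
      by_contra hne
      exact Set.disjoint_left.1 (hd _ _ hne) h.choose_spec hx
    simp only [u₀, dif_pos h, hi]
  have hL : LipschitzOnWith (∑ i, ∑ j, C i j) u₀ (⋃ i, K i) := by
    refine LipschitzOnWith.of_dist_le_mul fun x hx y hy => ?_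
    obtain ⟨i, hi⟩ := Set.mem_iUnion.1 hx
    obtain ⟨j, hj⟩ := Set.mem_iUnion.1 hy
    rw [hu₀ i x hi, hu₀ j y hj, Real.dist_eq]
    refine (hC i j x hi y hj).trans (mul_le_mul_of_nonneg_right ?_ dist_nonneg)
    refine NNReal.coe_le_coe.2 ?_
    exact (Finset.single_le_sum (f := fun j => C i j) (fun _ _ => zero_le)
      (Finset.mem_univ j)).trans
      (Finset.single_le_sum (f := fun i => ∑ j, C i j) (fun _ _ => zero_le) (Finset.mem_univ i))
  obtain ⟨u, hu, heq⟩ := hL.extend_real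
  exact ⟨_, u, hu, fun i x hx => (heq (Set.mem_iUnion.2 ⟨i, hx⟩)).symm.trans (hu₀ i x hx)⟩

theorem mainTheorem4 {X : Type*} [MetricSpace X] [CompleteSpace X]
    [TopologicalSpace.SeparableSpace X] [MeasurableSpace X] [BorelSpace X]
    (μ : Measure X) [IsProbabilityMeasure μ]
    (n : ℕ) (α : Fin n → ℝ) (hα : ∀ i, 0 < α i)
    (h : obsDiam'' μ α = 0) :
    admissibleFamilies μ α = ∅ ∨
      ∃ x : Fin n → X, Function.Injective x ∧ ∀ i, ENNReal.ofReal (α i) ≤ μ {x i} := by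
  refine (Set.eq_empty_or_nonempty _).imp_right ?_
  rintro ⟨A, hAm, hAd, hAα⟩
  -- The gap between `β i` and `α i` pays for inner regularity; `hatom` recovers `α i` at the end.
  choose β hβ hβα hatom using fun i => exists_lt_forall_measure_singleton μ (hα i)
  have hK : ∀ i, ∃ K ⊆ A i, IsCompact K ∧ ENNReal.ofReal (β i) < μ K := fun i =>
    (hAm i).exists_lt_isCompact_of_ne_top (measure_ne_top _ _)
      (((ENNReal.ofReal_lt_ofReal_iff (hα i)).2 (hβα i)).trans_le (hAα i))
  choose K hKA hKc hKβ using hK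
  obtain ⟨L, u, hu, hui⟩ := exists_lipschitzWith_eq_on_disjoint_compacts hKc
    fun i j hij => (hAd i j hij).mono (hKA i) (hKA j)
  obtain ⟨f, hf, hfu, hinj⟩ := exists_lipschitz_perturbation_ae_injective μ hu
  have hL : (0 : ℝ) < L + 1 := by positivity
  set g : X → ℝ := fun x => f x / (L + 1) with hg
  have hgl : LipschitzWith 1 g := by
    refine LipschitzWith.of_dist_le_mul fun x y => ?_
    have h1 := hf.dist_le_mul x y
    rw [Real.dist_eq] at h1 ⊢
    rw [hg, ← sub_div, abs_div, abs_of_pos hL, div_le_iff₀ hL]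
    simpa [mul_comm] using h1
  have hgm : Measurable g := hgl.continuous.measurable
  have hginj : ∀ᵐ x ∂μ, ∀ᵐ y ∂μ, g x = g y → x = y :=
    hinj.mono fun x hx => hx.mono fun y hy hxy => hy ((div_left_inj' hL.ne').1 hxy)
  have hdiam : partialDiam' (μ.map g) β = 0 := by
    simp only [obsDiam'', partialDiam'', ENNReal.iSup_eq_zero] at h
    exact h g hgl β ⟨hβ, fun i => (hβα i).le⟩
  have hne : (admissibleFamilies (μ.map g) β).Nonempty := by
    -- On `K i` the function `f` takes values in `[i, i + 1)`, so these disjoint intervals capture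
    -- the mass of the `K i`.
    refine ⟨fun i => (fun y => ⌊y * (L + 1)⌋) ⁻¹' {((i : ℕ) : ℤ)}, fun i => ?_,
      fun i j hij => ?_, fun i => ?_⟩
    · exact (Int.measurable_floor.comp (measurable_id.mul_const _)) (measurableSet_singleton _)
    · refine Disjoint.preimage _ (Set.disjoint_singleton.2 fun he => hij (Fin.ext ?_))
      exact_mod_cast he
    · refine (hKβ i).le.trans ((measure_mono fun x hx => ?_).trans
        (Measure.le_map_apply hgm.aemeasurable _))
      have h1 := hfu x
      rw [hui i x hx] at h1
      simp only [Set.mem_preimage, Set.mem_singleton_iff, hg, div_mul_cancel₀ _ hL.ne']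
      exact Int.floor_eq_iff.2 (by exact_mod_cast h1)
  have : IsFiniteMeasure (μ.map g) := inferInstance
  obtain ⟨b, hb, hbβ⟩ := exists_injective_atoms_of_partialDiam'_eq_zero (μ.map g) hβ hne hdiam
  choose x hxb hx using fun i => exists_measure_singleton_eq_measure_fiber μ hgm hginj
    ((ENNReal.ofReal_pos.2 (hβ i)).trans_le (hbβ i)).ne'
  exact ⟨x, fun i j hij => hb (by rw [← hxb i, ← hxb j, hij]),
    fun i => hatom i (x i) ((hbβ i).trans (hx i))⟩
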